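/- Let $n \ge 3$ and $k \ge 1$ be integers, let $s = \gcd(n,k)$, and assume that $n/s$ is odd. Put $d = (3^{2k}+1)/2$, and let $\mathrm{Tr}_n(z) = \sum_{j=0}^{n-1} z^{3^j}$ be the absolute trace from $\mathbb{F}_{3^n}$ to $\mathbb{F}_3$. For $i \in \mathbb{F}_3 = \{0,1,2\}$ let $$D_i = \{x \in \mathbb{F}_{3^n} : \mathrm{Tr}_n(x^d) = i\}.$$ Then each of $D_0, D_1, D_2$ is a partial geometric difference set in the additive group $(\mathbb{F}_{3^n},+)$ with parameters $$\bigl(3^n,\; 3^{n-1};\; 3^{2n-3}-3^{n+s-3},\; 3^{n+s-2}+3^{2n-3}-3^{n+s-3}\bigr),$$ and $D_0, D_1, D_2$ form a partition of $\mathbb{F}_{3^n}$. (For $s = 1$ the parameters are $(3^n, 3^{n-1}; 3^{2n-3}-3^{n-2}, 3^{n-1}+3^{2n-3}-3^{n-2})$.) Here a subset $S$ of a finite additive group $G$ is a partial geometric difference set with parameters $(v,\kappa;\alpha,\beta)$ if $v > \kappa > 2$, $|G| = v$, $|S| = \kappa$ and, with $\delta(g) = |\{(a,b) \in S\times S : g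 = a-b\}|$, for every $x \in G$ $$\sum_{y\in S}\delta(x-y) = \begin{cases}\alpha & \text{if } x\notin S,\\ \beta & \text{if } x \in S.\end{cases}$$ -/

import Mathlib

/-- `diffCount S g` is `δ(g)`, the number of pairs `(s, t) ∈ S × S` with `g = s - t`
(the group is written additively). -/
def diffCount {G : Type*} [AddGroup G] [DecidableEq G] (S : Finset G) (g : G) : ℕ :=
  ((S ×ˢ S).filter (fun st => g = st.1 - st.2)).card

/-- `S` is a partial geometric difference set with parameters `(v, k; α, β)` in the finite
additive group `G`: here `v > k > 2`, `G` has order `v`, `S` has `k` elements, and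
`∑_{y ∈ S} δ(x - y)` equals `β` for `x ∈ S` and `α` for `x ∉ S`. -/
structure IsPGDS {G : Type*} [AddGroup G] [DecidableEq G] (S : Finset G)
    (v k α β : ℕ) : Prop where
  two_lt : 2 < k
  lt : k < v
  card_group : Nat.card G = v
  card_set : S.card = k
  sum_of_notMem : ∀ x : G, x ∉ S → ∑ y ∈ S, diffCount S (x - y) = α
  sum_of_mem : ∀ x : G, x ∈ S → ∑ y ∈ S, diffCount S (x - y) = β

/-- The level set `D_i = {x : Tr(x ^ d) = i}` of the function `x ↦ Tr(x ^ d)`, where `Tr` is the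
absolute trace from a finite field `F` of characteristic `3` to `𝔽₃`. -/
noncomputable def traceLevelSet (F : Type*) [Field F] [Fintype F] [Algebra (ZMod 3) F]
    (d : ℕ) (i : ZMod 3) : Finset F :=
  Finset.univ.filter (fun x => Algebra.trace (ZMod 3) F (x ^ d) = i)

/-!
The partial geometric difference set property of `D_i` says that `D_i * (-D_i) * D_i` is a linear
combination of `D_i` and the whole group. By Fourier inversion this follows once the Fourier
coefficients of `D_i` at all nontrivial characters have squared absolute value `0` or
`3 ^ (n + s - 2)` (`card_mul_sum_diffCount`).

Since `d` is odd, these coefficients are combinations of `W(b)` and `W(-b)`, where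
`W(b) = ∑ ω ^ Tr (x ^ d + b x)`. It is therefore enough that `|W(b)|²` is `0` or `3 ^ (n + s)` and
that `W(b)` and `W(-b)` are never both nonzero (`walsh_trace_pow`); the case `b = 0` of the latter
gives `W(0) = 0`, hence `|D_i| = 3 ^ (n - 1)` (`card_mul_sum_diffCount_levelSet`).

Let `σ(x) = x ^ (3 ^ (2 k))`. As `n / s` is odd, its fixed field `K` has `3 ^ s` elements, and a
nonsquare `g` of `K` remains a nonsquare in the big field; moreover `g ^ d = g`. Splitting `x` into
squares `y²` and multiples `g y²` shows that `2 W(b)` is the sum of the exponential sums of `q` and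
`g q`, where `q(y) = Tr (y σ(y) + b y²)` is a quadratic form over `K` in the odd number `n / s` of
variables. If `q` has rank `r`, diagonalisation gives the sum for `q` the squared absolute value
`|K| ^ (2 n / s - r)` and shows that passing to `g q` multiplies the sum by `(-1) ^ r`
(`QuadraticForm.exists_rank_exponentialSum`). So `W(b) ≠ 0` only for even `r`, that is, for a
radical of odd dimension. The radical consists of the solutions of `σ(y) + σ⁻¹(y) + 2 b y = 0`, and
a Wronskian argument bounds its dimension by two (`card_twistedRadical_le`), so it is a line and
`|W(b)|² = 3 ^ (n + s)`.

Finally, for `y` and `z` in the radicals for `b` and `-b`, the element `y σ(z) + z σ(y)` is negated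
by `σ`, which has odd order; hence it vanishes, and so does `z` if `y ≠ 0`. Two opposite radicals
are thus never both nonzero (`eq_zero_of_mem_twistedRadical_neg`).
-/

open Finset ComplexConjugate

/-! ### Sums over squares and nonsquares -/

theorem FiniteField.sum_comp_sq {F : Type*} [Field F] [Fintype F] [DecidableEq F]
    (hF : ringChar F ≠ 2) (h : F → ℂ) :
    ∑ x, h (x ^ 2) = ∑ a, ((quadraticChar F a : ℂ) + 1) * h a := by
  rw [← Finset.sum_fiberwise univ (fun x : F => x ^ 2)]
  refine Finset.sum_congr rfl fun a _ => ?_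
  rw [Finset.sum_congr rfl (g := fun _ => h a)
    (fun x hx => by rw [(Finset.mem_filter.1 hx).2]), Finset.sum_const, nsmul_eq_mul]
  congr 1
  have := quadraticChar_card_sqrts hF a
  rw [Set.toFinset_ofPred] at this
  exact_mod_cast this

/-- Squares and `g`-multiples of squares together cover the field twice. -/
theorem FiniteField.sum_comp_sq_add_sum_comp_mul_sq {F : Type*} [Field F] [Fintype F]
    (hF : ringChar F ≠ 2) {g : F} (hg : ¬ IsSquare g) (h : F → ℂ) :
    ∑ x, h (x ^ 2) + ∑ x, h (g * x ^ 2) = 2 * ∑ x, h x := by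
  classical
  have hg0 : g ≠ 0 := fun h => hg (h ▸ IsSquare.zero)
  rw [FiniteField.sum_comp_sq hF h, FiniteField.sum_comp_sq hF (fun a => h (g * a)),
    ← Equiv.sum_comp (Equiv.mulLeft₀ g hg0) (fun a => ((quadraticChar F a : ℂ) + 1) * h a),
    ← Equiv.sum_comp (Equiv.mulLeft₀ g hg0) h, Finset.mul_sum, ← Finset.sum_add_distrib]
  refine Finset.sum_congr rfl fun a _ => ?_
  simp only [Equiv.mulLeft₀_apply, map_mul, quadraticChar_neg_one_iff_not_isSquare.2 hg]
  push_cast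
  ring

/-! ### Exponential sums of quadratic forms -/

theorem AddChar.sum_comp_mul_conj {A H : Type*} [AddCommGroup A] [Fintype A] [AddCommGroup H]
    [Finite H] (ψ : AddChar H ℂ) (φ : A → H) :
    (∑ y, ψ (φ y)) * conj (∑ y, ψ (φ y)) = ∑ y, ∑ z, ψ (φ (y + z) - φ z) := by
  rw [map_sum, Finset.sum_mul_sum, Finset.sum_comm]
  conv_rhs => rw [Finset.sum_comm]
  refine Finset.sum_congr rfl fun z _ => ?_
  rw [← Equiv.sum_comp (Equiv.addRight z)]
  refine Finset.sum_congr rfl fun y _ => ?_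
  rw [sub_eq_add_neg, AddChar.map_add_eq_mul, AddChar.map_neg_eq_conj, Equiv.coe_addRight]

theorem AddChar.map_finsetSum_eq_prod {A ι : Type*} [AddCommGroup A] (ψ : AddChar A ℂ) (s : Finset ι)
    (f : ι → A) : ψ (∑ i ∈ s, f i) = ∏ i ∈ s, ψ (f i) :=
  _root_.map_prod ψ.toMonoidHom (fun i => Multiplicative.ofAdd (f i)) s

section QuadraticForm

variable {K : Type*} [Field K] [Fintype K] {ψ : AddChar K ℂ}

theorem AddChar.sum_mul_sq_mul_conj (hK : ringChar K ≠ 2) (hψ : ψ.IsPrimitive) {a : K}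
    (ha : a ≠ 0) :
    (∑ x, ψ (a * x ^ 2)) * conj (∑ x, ψ (a * x ^ 2)) = Fintype.card K := by
  classical
  rw [AddChar.sum_comp_mul_conj ψ (fun x => a * x ^ 2)]
  have h2 : (2 : K) ≠ 0 := Ring.two_ne_zero hK
  have key : ∀ y z : K, ψ (a * (y + z) ^ 2 - a * z ^ 2) = ψ (a * y ^ 2) * ψ (z * (2 * a * y)) := by
    intro y z
    rw [← AddChar.map_add_eq_mul]
    congr 1
    ring
  simp_rw [key, ← Finset.mul_sum, AddChar.sum_mulShift _ hψ]
  simp [h2, ha]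

theorem AddChar.sum_nonsquare_mul_sq (hK : ringChar K ≠ 2) (hψ : ψ.IsPrimitive) {a g : K}
    (ha : a ≠ 0) (hg : ¬ IsSquare g) :
    ∑ x, ψ (g * (a * x ^ 2)) = - ∑ x, ψ (a * x ^ 2) := by
  classical
  have h := FiniteField.sum_comp_sq_add_sum_comp_mul_sq hK hg (fun x => ψ (x * a))
  rw [AddChar.sum_mulShift _ hψ, if_neg ha, Nat.cast_zero, mul_zero] at h
  rw [eq_neg_iff_add_eq_zero, add_comm, ← h]
  congr 1 <;> exact Finset.sum_congr rfl fun x _ => by ring_nf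

theorem AddChar.sum_weightedSumSquares {ι : Type*} [Fintype ι] [DecidableEq ι] (w : ι → K)
    (c : K) :
    ∑ v, ψ (c * QuadraticMap.weightedSumSquares K w v) = ∏ i, ∑ x, ψ (c * (w i * x ^ 2)) := by
  rw [Fintype.prod_sum]
  refine Finset.sum_congr rfl fun v _ => ?_
  rw [QuadraticMap.weightedSumSquares_apply, Finset.mul_sum, AddChar.map_finsetSum_eq_prod]
  simp [sq]

/-- The number `r` is the rank of `q`: diagonalising `q` turns the exponential sum into a product
of `r` quadratic Gauss sums, each of absolute value `√|K|` and each changing sign under a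
nonsquare factor, and of trivial sums, each equal to `|K|`. -/
theorem QuadraticForm.exists_rank_exponentialSum {V : Type*} [AddCommGroup V] [Module K V]
    [Module.Finite K V] [Fintype V] (hK : ringChar K ≠ 2) (hψ : ψ.IsPrimitive)
    (q : QuadraticForm K V) :
    ∃ r ≤ Module.finrank K V,
      (∑ y, ψ (q y)) * conj (∑ y, ψ (q y)) =
        (Fintype.card K : ℂ) ^ (2 * Module.finrank K V - r) ∧
      ∀ g : K, ¬ IsSquare g → ∑ y, ψ (g * q y) = (-1) ^ r * ∑ y, ψ (q y) := by
  classical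
  have h2 : (2 : K) ≠ 0 := Ring.two_ne_zero hK
  let : Invertible (2 : K) := invertibleOfNonzero h2
  obtain ⟨w, ⟨e⟩⟩ := QuadraticForm.equivalent_weightedSumSquares q
  have hsum : ∀ c : K, ∑ y, ψ (c * q y) = ∏ i, ∑ x, ψ (c * (w i * x ^ 2)) := by
    intro c
    rw [← AddChar.sum_weightedSumSquares, ← Equiv.sum_comp e.toEquiv]
    refine Finset.sum_congr rfl fun y _ => ?_
    congr 2
    exact (e.map_app y).symm
  have h1 : ∑ y, ψ (q y) = ∏ i, ∑ x, ψ (w i * x ^ 2) := by simpa using hsum 1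
  set s : Finset (Fin (Module.finrank K V)) := univ.filter (fun i => w i ≠ 0) with hs
  have hcard : s.card + sᶜ.card = Module.finrank K V := by
    rw [Finset.card_add_card_compl, Fintype.card_fin]
  refine ⟨s.card, by omega, ?_, fun g hg => ?_⟩
  · rw [h1, map_prod, ← Finset.prod_mul_distrib, ← Finset.prod_mul_prod_compl s,
      Finset.prod_congr rfl (g := fun _ => (Fintype.card K : ℂ)),
      Finset.prod_congr (s₁ := sᶜ) rfl (g := fun _ => (Fintype.card K : ℂ) ^ 2),
      Finset.prod_const, Finset.prod_const, ← pow_mul, ← pow_add]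
    · congr 1
      omega
    · intro i hi
      have : w i = 0 := by simpa [hs] using hi
      simp [this, sq]
    · intro i hi
      exact AddChar.sum_mul_sq_mul_conj hK hψ (by simpa [hs] using hi)
  · rw [hsum, h1, ← Finset.prod_mul_prod_compl s, ← Finset.prod_mul_prod_compl s, ← mul_assoc]
    congr 1
    · rw [← Finset.prod_const, ← Finset.prod_mul_distrib]
      refine Finset.prod_congr rfl fun i hi => ?_
      rw [AddChar.sum_nonsquare_mul_sq hK hψ (by simpa [hs] using hi) hg, neg_one_mul]
    · refine Finset.prod_congr rfl fun i hi => ?_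
      have : w i = 0 := by simpa [hs] using hi
      simp [this]

end QuadraticForm

/-! ### The forms `Tr (y σ(y) + b y²)` -/

/-- A nontrivial additive character composed with the trace is again nontrivial, because the trace
of an extension of finite fields is surjective. -/
theorem AddChar.isPrimitive_compAddMonoidHom_trace {K F R : Type*} [Field K] [Finite K] [Field F]
    [Finite F] [Algebra K F] [CommRing R] {ψ : AddChar K R} (hψ : ψ.IsPrimitive) :
    (ψ.compAddMonoidHom (Algebra.trace K F).toAddMonoidHom).IsPrimitive := by
  refine AddChar.IsPrimitive.of_ne_one fun h => ?_
  refine hψ one_ne_zero ?_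
  ext a
  obtain ⟨x, rfl⟩ := Algebra.trace_surjective K F a
  simpa using DFunLike.congr_fun h x

section TwistedForm

variable {K F : Type*} [Field K] [Field F] [Algebra K F]

/-- The quadratic form `y ↦ Tr (y σ(y) + b y²)` over `K` on the extension `F`. -/
noncomputable def twistedForm (σ : F ≃ₐ[K] F) (b : F) : QuadraticForm K F :=
  LinearMap.BilinMap.toQuadraticMap
    ((Algebra.traceForm K F).compl₂ (σ.toLinearMap + LinearMap.mulLeft K b))

theorem twistedForm_apply (σ : F ≃ₐ[K] F) (b y : F) :
    twistedForm σ b y = Algebra.trace K F (y * σ y + b * y ^ 2) := by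
  simp [twistedForm, Algebra.traceForm_apply, mul_add]
  ring_nf

variable [Fintype F] [DecidableEq F]

/-- The radical of `twistedForm σ b`: the polar form pairs `y` and `z` to
`Tr (z (σ(y) + σ⁻¹(y) + 2 b y))`. -/
def twistedRadical (σ : F ≃ₐ[K] F) (b : F) : Finset F :=
  univ.filter (fun y => σ y + σ.symm y + 2 * b * y = 0)

theorem mem_twistedRadical {σ : F ≃ₐ[K] F} {b y : F} :
    y ∈ twistedRadical σ b ↔ σ y + σ.symm y + 2 * b * y = 0 := by
  simp [twistedRadical]

/-- Any two elements `y, z` of the radical have a Wronskian `y σ(z) - z σ(y)` fixed by `σ`. Hence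
the radical has dimension at most two over the fixed field. -/
theorem card_twistedRadical_le [Fintype K] {σ : F ≃ₐ[K] F}
    (hfix : ∀ x, σ x = x → ∃ a, algebraMap K F a = x) (b : F) :
    (twistedRadical σ b).card ≤ Fintype.card K ^ 2 := by
  classical
  by_cases h : ∃ y ∈ twistedRadical σ b, y ≠ 0
  swap
  · push Not at h
    calc (twistedRadical σ b).card ≤ ({0} : Finset F).card :=
          Finset.card_le_card fun y hy => by simpa using h y hy
      _ ≤ Fintype.card K ^ 2 := by
          simpa using Nat.one_le_pow _ _ Fintype.card_pos
  obtain ⟨y, hy, hy0⟩ := h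
  have hσy : σ y ≠ 0 := by simpa using hy0
  have hK : (univ.image (algebraMap K F)).card ≤ Fintype.card K := Finset.card_image_le
  have hmaps : ∀ z ∈ twistedRadical σ b, y * σ z - z * σ y ∈ univ.image (algebraMap K F) := by
    intro z hz
    rw [mem_twistedRadical] at hy hz
    have hw : σ.symm (y * σ z - z * σ y) = y * σ z - z * σ y := by
      simp only [map_sub, map_mul, AlgEquiv.symm_apply_apply]
      linear_combination z * hy - y * hz
    obtain ⟨a, ha⟩ := hfix (y * σ z - z * σ y) (by rw [← hw, AlgEquiv.apply_symm_apply, hw])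
    exact Finset.mem_image.2 ⟨a, Finset.mem_univ _, ha⟩
  refine (Finset.card_le_mul_card_image_of_maps_to hmaps (Fintype.card K) fun w _ => ?_).trans ?_
  · by_cases hne : ((twistedRadical σ b).filter (fun z => y * σ z - z * σ y = w)).Nonempty
    swap
    · rw [Finset.not_nonempty_iff_eq_empty.1 hne]
      simp
    obtain ⟨z₀, hz₀⟩ := hne
    have hz₀' := (Finset.mem_filter.1 hz₀).2
    -- two elements with the same Wronskian against `y` differ by a `K`-multiple of `y`
    calc _ ≤ (univ.image fun a : K => z₀ + algebraMap K F a * y).card := by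
          refine Finset.card_le_card fun z hz => ?_
          have hz' := (Finset.mem_filter.1 hz).2
          obtain ⟨a, ha⟩ := hfix ((z - z₀) / y) (by
            rw [map_div₀, map_sub, div_eq_div_iff hσy hy0]
            linear_combination hz' - hz₀')
          refine Finset.mem_image.2 ⟨a, Finset.mem_univ _, ?_⟩
          rw [ha]
          field_simp
          ring
      _ ≤ Fintype.card K := Finset.card_image_le
  · rw [sq]
    exact Nat.mul_le_mul_left _ hK

omit [Fintype F] [DecidableEq F] in
/-- An automorphism of odd order has no eigenvalue `-1`. -/
theorem AlgEquiv.eq_zero_of_map_eq_neg (hF : (2 : F) ≠ 0) {σ : F ≃ₐ[K] F} {m : ℕ} (hm : Odd m)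
    (hσ : σ ^ m = 1) {x : F} (hx : σ x = -x) : x = 0 := by
  have h : ∀ j : ℕ, (σ ^ j) x = (-1) ^ j * x := by
    intro j
    induction j with
    | zero => simp
    | succ j ih => rw [pow_succ, AlgEquiv.mul_apply, hx, map_neg, ih]; ring
  have := h m
  rw [hσ, hm.neg_one_pow, AlgEquiv.one_apply] at this
  have h2 : 2 * x = 0 := by linear_combination this
  exact (mul_eq_zero.1 h2).resolve_left hF

/-- If `y` and `z` lie in the radicals for `b` and `-b`, then `y σ(z) + z σ(y)` is an eigenvector of
`σ` for the eigenvalue `-1`, hence zero; then `z / y` is another one. -/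
theorem eq_zero_of_mem_twistedRadical_neg (hF : (2 : F) ≠ 0) {σ : F ≃ₐ[K] F} {m : ℕ} (hm : Odd m)
    (hσ : σ ^ m = 1) {b y z : F} (hy : y ∈ twistedRadical σ b) (hy0 : y ≠ 0)
    (hz : z ∈ twistedRadical σ (-b)) : z = 0 := by
  rw [mem_twistedRadical] at hy hz
  have hσy : σ y ≠ 0 := by simpa using hy0
  have hw : σ.symm (y * σ z + z * σ y) = -(y * σ z + z * σ y) := by
    simp only [map_add, map_mul, AlgEquiv.symm_apply_apply]
    linear_combination z * hy + y * hz
  have hw0 : y * σ z + z * σ y = 0 := by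
    refine AlgEquiv.eq_zero_of_map_eq_neg hF hm hσ ?_
    have := congrArg σ hw
    rw [AlgEquiv.apply_symm_apply, map_neg] at this
    exact (neg_eq_iff_eq_neg.2 this).symm
  have ht : z / y = 0 := by
    refine AlgEquiv.eq_zero_of_map_eq_neg hF hm hσ ?_
    rw [map_div₀, ← neg_div, div_eq_div_iff hσy hy0]
    linear_combination hw0
  exact (div_eq_zero_iff.1 ht).resolve_right hy0

variable [Fintype K] {ψ : AddChar K ℂ}

theorem sum_twistedForm_mul_conj (hF : (2 : F) ≠ 0) (hψ : ψ.IsPrimitive) (σ : F ≃ₐ[K] F) (b : F) :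
    (∑ y, ψ (twistedForm σ b y)) * conj (∑ y, ψ (twistedForm σ b y)) =
      Fintype.card F * (twistedRadical σ b).card := by
  set Ψ : AddChar F ℂ := ψ.compAddMonoidHom (Algebra.trace K F).toAddMonoidHom with hΨ
  have hprim : Ψ.IsPrimitive := AddChar.isPrimitive_compAddMonoidHom_trace hψ
  have happ : ∀ x, Ψ x = ψ (Algebra.trace K F x) := fun x => rfl
  have hσ : ∀ x, Algebra.trace K F (σ x) = Algebra.trace K F x :=
    fun x => Algebra.trace_eq_of_algEquiv σ x
  have key : ∀ y z, ψ (twistedForm σ b (y + z) - twistedForm σ b z) =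
      ψ (twistedForm σ b y) * Ψ (z * (σ y + σ.symm y + 2 * b * y)) := by
    intro y z
    have h1 : Algebra.trace K F (y * σ z) = Algebra.trace K F (z * σ.symm y) := by
      rw [← hσ (z * σ.symm y), map_mul σ, AlgEquiv.apply_symm_apply, mul_comm]
    rw [happ, ← AddChar.map_add_eq_mul, twistedForm_apply, twistedForm_apply, twistedForm_apply]
    congr 1
    have e1 : (y + z) * σ (y + z) + b * (y + z) ^ 2 =
        (z * σ z + b * z ^ 2) + (y * σ y + b * y ^ 2) + z * σ y + y * σ z + z * (2 * b * y) := by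
      rw [map_add]; ring
    rw [e1, mul_add, mul_add]
    simp only [map_add, h1]
    ring
  rw [AddChar.sum_comp_mul_conj ψ (fun y => twistedForm σ b y)]
  simp_rw [key, ← Finset.mul_sum, AddChar.sum_mulShift _ hprim]
  -- on its radical the form itself vanishes, since there `2 q(y) = Tr (y (σ y + σ⁻¹ y + 2 b y))`
  have hrad : ∀ y ∈ twistedRadical σ b, ψ (twistedForm σ b y) = 1 := by
    intro y hy
    rw [mem_twistedRadical] at hy
    have h1 : Algebra.trace K F (y * σ.symm y) = Algebra.trace K F (y * σ y) := by
      rw [← hσ (y * σ.symm y), map_mul σ, AlgEquiv.apply_symm_apply, mul_comm]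
    have h2 : (2 : K) * twistedForm σ b y = 0 := by
      calc (2 : K) * twistedForm σ b y
          = Algebra.trace K F (y * (σ y + σ.symm y + 2 * b * y)) := by
            have e : y * (σ y + σ.symm y + 2 * b * y) =
              y * σ y + y * σ.symm y + (b * y ^ 2 + b * y ^ 2) := by ring
            rw [twistedForm_apply, e]
            simp only [map_add, h1]
            ring
        _ = 0 := by rw [hy, mul_zero, map_zero]
    have hK2 : (2 : K) ≠ 0 := fun h => hF (by
      rw [← map_ofNat (algebraMap K F) 2, h, map_zero])
    rw [(mul_eq_zero.1 h2).resolve_left hK2, AddChar.map_zero_eq_one]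
  rw [twistedRadical] at *
  simp only [Nat.cast_ite, Nat.cast_zero, mul_ite, mul_zero, ← Finset.sum_filter]
  rw [Finset.sum_congr rfl fun y hy => by rw [hrad y hy, one_mul], Finset.sum_const, nsmul_eq_mul,
    mul_comm]

/-- The exponential sum attached to `y σ(y) + b y²`, summed over the forms with scalar factors `1`
and a nonsquare `g`. It vanishes unless the rank is even, and as `[F : K]` is odd and the radical
has dimension at most two, an even rank forces the radical to be a line. -/
theorem sum_twistedForm_add_nonsquare (hK : ringChar K ≠ 2) (hψ : ψ.IsPrimitive) {σ : F ≃ₐ[K] F}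
    (hfix : ∀ x, σ x = x → ∃ a, algebraMap K F a = x) (hm : Odd (Module.finrank K F))
    {g : K} (hg : ¬ IsSquare g) (b : F)
    (h : ∑ y, ψ (twistedForm σ b y) + ∑ y, ψ (g * twistedForm σ b y) ≠ 0) :
    (∑ y, ψ (twistedForm σ b y) + ∑ y, ψ (g * twistedForm σ b y)) *
      conj (∑ y, ψ (twistedForm σ b y) + ∑ y, ψ (g * twistedForm σ b y)) =
      4 * (Fintype.card K : ℂ) ^ (Module.finrank K F + 1) ∧
    1 < (twistedRadical σ b).card := by
  have hK2 : (2 : K) ≠ 0 := Ring.two_ne_zero hK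
  have hF2 : (2 : F) ≠ 0 := by
    rwa [← map_ofNat (algebraMap K F) 2, Ne, map_eq_zero]
  -- comparing the two evaluations of `|S|²` shows that the radical has dimension `m - r`
  obtain ⟨r, hr, hS, hgS⟩ := QuadraticForm.exists_rank_exponentialSum hK hψ (twistedForm σ b)
  rw [hgS g hg] at h ⊢
  have hr2 : Even r := by
    by_contra hodd
    rw [Nat.not_even_iff_odd] at hodd
    exact h (by rw [hodd.neg_one_pow]; ring)
  have hcK : 1 < Fintype.card K := Fintype.one_lt_card
  have hrad := sum_twistedForm_mul_conj hF2 hψ σ b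
  have hle := card_twistedRadical_le hfix b
  set m := Module.finrank K F with hmdef
  rw [hS, Module.card_eq_pow_finrank (K := K) (V := F), ← hmdef] at hrad
  have hcard : (twistedRadical σ b).card = Fintype.card K ^ (m - r) := by
    have h1 : Fintype.card K ^ (2 * m - r) =
        Fintype.card K ^ m * (twistedRadical σ b).card := by exact_mod_cast hrad
    rw [show 2 * m - r = m + (m - r) by omega, pow_add] at h1
    exact (Nat.eq_of_mul_eq_mul_left (by positivity) h1).symm
  have hmr : m - r = 1 := by
    rw [hcard] at hle
    have := (Nat.pow_le_pow_iff_right hcK).1 hle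
    obtain ⟨a, ha⟩ := hm
    obtain ⟨c, hc⟩ := hr2
    omega
  refine ⟨?_, by rwa [hcard, hmr, pow_one]⟩
  rw [show 2 * m - r = m + 1 by omega] at hS
  rw [hr2.neg_one_pow, one_mul, ← two_mul, map_mul, Complex.conj_ofNat, ← hS]
  ring

end TwistedForm

/-! ### Difference counts by Fourier inversion -/

section Fourier

variable {F : Type*} [Field F] [Fintype F] [DecidableEq F]

theorem AddChar.sum_mul_eq_card_mul_ite {Ψ : AddChar F ℂ} (hΨ : Ψ.IsPrimitive) (a : F) :
    (∑ b, Ψ (b * a)) = (Fintype.card F : ℂ) * if a = 0 then 1 else 0 := by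
  rw [AddChar.sum_mulShift _ hΨ]
  split_ifs <;> simp

/-- If `|Ŝ(b)|²` takes no nonzero value other than `C` at the nontrivial characters, then
`S * (-S) * S` is a combination of `S` and the constant function. -/
theorem card_mul_sum_diffCount {Ψ : AddChar F ℂ} (hΨ : Ψ.IsPrimitive) (S : Finset F) (C : ℂ)
    (hC : ∀ b, b ≠ 0 → (∑ y ∈ S, Ψ (b * y)) * conj (∑ y ∈ S, Ψ (b * y)) * (∑ y ∈ S, Ψ (b * y)) =
      C * ∑ y ∈ S, Ψ (b * y)) (x : F) :
    (Fintype.card F : ℂ) * (∑ y ∈ S, diffCount S (x - y) : ℕ) =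
      (S.card : ℂ) ^ 3 - C * S.card + C * (Fintype.card F * if x ∈ S then 1 else 0) := by
  set D : F → ℂ := fun b => ∑ y ∈ S, Ψ (b * y) with hD
  have hD0 : D 0 = S.card := by simp [hD]
  have h1 : (Fintype.card F : ℂ) * (∑ y ∈ S, diffCount S (x - y) : ℕ) =
      ∑ b, D b * conj (D b) * D b * Ψ (b * (-x)) := by
    have hcount : ∀ y, (diffCount S (x - y) : ℂ) =
        ∑ u ∈ S, ∑ t ∈ S, if y + u - t - x = 0 then (1 : ℂ) else 0 := by
      intro y
      rw [diffCount, Finset.card_filter, Finset.sum_product]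
      push_cast
      refine Finset.sum_congr rfl fun u _ => Finset.sum_congr rfl fun t _ => ?_
      congr 1
      exact propext ⟨fun h => by linear_combination -h, fun h => by linear_combination -h⟩
    push_cast
    simp_rw [hcount, Finset.mul_sum, ← AddChar.sum_mul_eq_card_mul_ite hΨ]
    have hexp : ∀ b, D b * conj (D b) * D b * Ψ (b * (-x)) =
        ∑ y ∈ S, ∑ u ∈ S, ∑ t ∈ S, Ψ (b * (y + u - t - x)) := by
      intro b
      have hterm : ∀ y u t, Ψ (b * (y + u - t - x)) =
          Ψ (b * y) * (Ψ (b * u) * (conj (Ψ (b * t)) * Ψ (b * (-x)))) := by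
        intro y u t
        simp only [← AddChar.map_neg_eq_conj, ← AddChar.map_add_eq_mul]
        congr 1
        ring
      simp_rw [hterm, ← Finset.mul_sum, ← Finset.sum_mul, ← map_sum]
      ring
    simp_rw [hexp]
    symm
    rw [Finset.sum_comm]
    refine Finset.sum_congr rfl fun y _ => ?_
    rw [Finset.sum_comm]
    refine Finset.sum_congr rfl fun u _ => ?_
    rw [Finset.sum_comm]
  have h2 : ∑ b, D b * Ψ (b * (-x)) = Fintype.card F * if x ∈ S then 1 else 0 := by
    simp_rw [hD, Finset.sum_mul, ← AddChar.map_add_eq_mul, ← mul_add]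
    rw [Finset.sum_comm]
    simp_rw [AddChar.sum_mul_eq_card_mul_ite hΨ, ← sub_eq_add_neg, sub_eq_zero, ← Finset.mul_sum,
      Finset.sum_ite_eq']
  -- nothing is assumed at the trivial character, which therefore contributes a correction term
  have h3 : ∀ b, D b * conj (D b) * D b * Ψ (b * (-x)) =
      C * (D b * Ψ (b * (-x))) + if b = 0 then (S.card : ℂ) ^ 3 - C * S.card else 0 := by
    intro b
    split_ifs with hb
    · subst hb
      rw [hD0, zero_mul, AddChar.map_zero_eq_one, Complex.conj_natCast]
      ring
    · rw [hC b hb]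
      ring
  rw [h1, Finset.sum_congr rfl fun b _ => h3 b, Finset.sum_add_distrib, ← Finset.mul_sum, h2,
    Finset.sum_ite_eq', if_pos (Finset.mem_univ _)]
  ring

end Fourier

/-! ### Level sets of odd plateaued functions -/

theorem ZMod.stdAddChar_three_sum (a : ZMod 3) :
    1 + ZMod.stdAddChar (N := 3) a + ZMod.stdAddChar (N := 3) (-a) =
      (3 : ℂ) * if a = 0 then 1 else 0 := by
  have h := AddChar.sum_mulShift a (ZMod.isPrimitive_stdAddChar 3)
  have hu : (univ : Finset (ZMod 3)) = {0, 1, -1} := by decide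
  rw [hu, Finset.sum_insert (by decide), Finset.sum_insert (by decide), Finset.sum_singleton,
    zero_mul, one_mul, neg_one_mul, AddChar.map_zero_eq_one, ← add_assoc] at h
  rw [h, ZMod.card]
  split_ifs <;> simp

section LevelSet

variable {F : Type*} [Field F] [Fintype F] [DecidableEq F]

omit [DecidableEq F] in
theorem three_mul_sum_levelSet (Ψ : AddChar F ℂ) {f : F → ZMod 3} (hf : ∀ x, f (-x) = -f x)
    (i : ZMod 3) (b : F) :
    3 * ∑ y ∈ univ.filter (fun x => f x = i), Ψ (b * y) =
      ∑ x, Ψ (x * b) + ZMod.stdAddChar (-i) * ∑ x, ZMod.stdAddChar (f x) * Ψ (b * x) +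
        ZMod.stdAddChar i * ∑ x, ZMod.stdAddChar (f x) * Ψ (-b * x) := by
  have hneg : ∑ x, ZMod.stdAddChar (f x) * Ψ (-b * x) =
      ∑ x, ZMod.stdAddChar (-f x) * Ψ (b * x) := by
    rw [← Equiv.sum_comp (Equiv.neg F)]
    exact Finset.sum_congr rfl fun x _ => by simp [hf]
  rw [hneg, Finset.sum_filter, Finset.mul_sum, Finset.mul_sum, Finset.mul_sum,
    ← Finset.sum_add_distrib, ← Finset.sum_add_distrib]
  refine Finset.sum_congr rfl fun x _ => ?_
  have h := ZMod.stdAddChar_three_sum (f x - i)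
  rw [neg_sub, sub_eq_add_neg, sub_eq_add_neg, AddChar.map_add_eq_mul, AddChar.map_add_eq_mul,
    ← sub_eq_add_neg] at h
  simp only [sub_eq_zero] at h
  rw [mul_comm x b]
  split_ifs with hx
  · rw [if_pos hx] at h
    linear_combination -Ψ (b * x) * h
  · rw [if_neg hx] at h
    linear_combination -Ψ (b * x) * h

/-- If the Walsh transform `W` of an odd function `f` has `|W(b)|² ∈ {0, 9 C}` and no two opposite
points in its support, then at every nonzero `b` the Fourier transform of a level set of `f` is,
up to a third root of unity, one of `0`, `W(b) / 3`, `W(-b) / 3`. -/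
theorem card_mul_sum_diffCount_levelSet {Ψ : AddChar F ℂ} (hΨ : Ψ.IsPrimitive) {f : F → ZMod 3}
    (hf : ∀ x, f (-x) = -f x) (C : ℂ) (W : F → ℂ)
    (hW : ∀ b, W b = ∑ x, ZMod.stdAddChar (f x) * Ψ (b * x))
    (hC : ∀ b, W b ≠ 0 → W b * conj (W b) = 9 * C) (hsupp : ∀ b, W b = 0 ∨ W (-b) = 0)
    (i : ZMod 3) :
    3 * ((univ.filter (fun x => f x = i)).card : ℂ) = Fintype.card F ∧
    ∀ x, (Fintype.card F : ℂ) *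
        (∑ y ∈ univ.filter (fun x => f x = i),
          diffCount (univ.filter (fun x => f x = i)) (x - y) : ℕ) =
      ((univ.filter (fun x => f x = i)).card : ℂ) ^ 3
        - C * (univ.filter (fun x => f x = i)).card +
        C * (Fintype.card F * if f x = i then 1 else 0) := by
  have hD := fun b => three_mul_sum_levelSet Ψ hf i b
  simp only [← hW, AddChar.sum_mulShift _ hΨ] at hD
  have hunit : ∀ a : ZMod 3, ZMod.stdAddChar a * conj (ZMod.stdAddChar (N := 3) a) = 1 := by
    intro a
    rw [← AddChar.map_neg_eq_conj, ← AddChar.map_add_eq_mul, add_neg_cancel,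
      AddChar.map_zero_eq_one]
  constructor
  · have h0 : W 0 = 0 := by simpa using hsupp 0
    simpa [h0] using hD 0
  · intro x
    have := card_mul_sum_diffCount hΨ (univ.filter (fun x => f x = i)) C (fun b hb => ?_) x
    · simpa using this
    · have h := hD b
      rw [if_neg hb, Nat.cast_zero, zero_add] at h
      set E := ∑ y ∈ univ.filter (fun x => f x = i), Ψ (b * y)
      have key : ∀ (a : ZMod 3) (c : F), 3 * E = ZMod.stdAddChar a * W c →
          E * conj E * E = C * E := by
        intro a c hE
        by_cases hc : W c = 0
        · have : E = 0 := by simpa [hc] using hE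
          simp [this]
        · have h1 : (3 * E) * conj (3 * E) = 9 * C := by
            rw [hE, map_mul, ← hC c hc]
            linear_combination (W c * conj (W c)) * hunit a
          rw [map_mul, Complex.conj_ofNat] at h1
          linear_combination E / 9 * h1
      rcases hsupp b with h0 | h0
      · exact key i (-b) (by rw [h, h0]; ring)
      · exact key (-i) b (by rw [h, h0]; ring)

end LevelSet

/-! ### The power function `x ^ ((3 ^ (2 k) + 1) / 2)` -/

section Frobenius

theorem Nat.gcd_two_mul_of_odd_div {n k s : ℕ} (hs : Nat.gcd n k = s) (hodd : Odd (n / s)) :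
    Nat.gcd n (2 * k) = s := by
  have hs0 : 0 < s := by
    rcases Nat.eq_zero_or_pos s with h | h
    · simp [h] at hodd
    · exact h
  subst hs
  obtain ⟨m, k', hc, hm, hk⟩ := Nat.exists_coprime n k
  set s := Nat.gcd n k
  rw [hm, Nat.mul_div_cancel _ hs0] at hodd
  conv_lhs => rw [hm, hk, ← mul_assoc, Nat.gcd_mul_right]
  rw [Nat.Coprime.gcd_mul_left_cancel_right _ (Nat.coprime_two_left.2 hodd), hc, one_mul]

/-- The automorphism `x ↦ x ^ (3 ^ j)` of a field with `3 ^ n` elements, as an automorphism over its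
fixed field. -/
theorem exists_fixedField_pow_three_pow {F : Type*} [Field F] [Fintype F] [Algebra (ZMod 3) F]
    {n : ℕ} (hn : n ≠ 0) (hF : Fintype.card F = 3 ^ n) (j : ℕ) :
    ∃ (K : IntermediateField (ZMod 3) F) (σ : F ≃ₐ[K] F), (∀ x, σ x = x ^ 3 ^ j) ∧
      (∀ x, σ x = x → ∃ a, algebraMap K F a = x) ∧ Module.finrank K F = n / Nat.gcd n j ∧
      Nat.card K = 3 ^ Nat.gcd n j ∧ σ ^ (n / Nat.gcd n j) = 1 := by
  have : Module.Finite (ZMod 3) F := Module.Finite.of_finite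
  have hfin : Module.finrank (ZMod 3) F = n := by
    have := Module.card_eq_pow_finrank (K := ZMod 3) (V := F)
    rw [hF, ZMod.card] at this
    exact (Nat.pow_right_injective (a := 3) (by norm_num) this).symm
  set τ : Gal(F/ZMod 3) := FiniteField.frobeniusAlgEquivOfAlgebraic (ZMod 3) F ^ j with hτ
  have hτapp : ∀ x, τ x = x ^ 3 ^ j := by
    intro x
    rw [hτ, AlgEquiv.coe_pow, FiniteField.coe_frobeniusAlgEquivOfAlgebraic_iterate, ZMod.card]
  have hord : orderOf τ = n / Nat.gcd n j := by
    rw [hτ, orderOf_pow, FiniteField.orderOf_frobeniusAlgEquivOfAlgebraic, hfin]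
  set K := IntermediateField.fixedField (Subgroup.zpowers τ) with hKdef
  have hmemK : ∀ x, x ∈ K ↔ τ x = x := by
    intro x
    rw [hKdef, IntermediateField.mem_fixedField_iff]
    constructor
    · exact fun h => h τ (Subgroup.mem_zpowers τ)
    · intro h ρ hρ
      have : Subgroup.zpowers τ ≤ MulAction.stabilizer Gal(F/ZMod 3) x :=
        Subgroup.zpowers_le.2 (by simpa [MulAction.mem_stabilizer_iff] using h)
      simpa [MulAction.mem_stabilizer_iff] using this hρ
  let σ : F ≃ₐ[K] F := { τ with commutes' := fun a => (hmemK a).1 a.2 }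
  have hσapp : ∀ x, σ x = τ x := fun _ => rfl
  have hrank : Module.finrank K F = n / Nat.gcd n j := by
    rw [hKdef, IntermediateField.finrank_fixedField_eq_card, Nat.card_zpowers, hord]
  refine ⟨K, σ, fun x => by rw [hσapp, hτapp], fun x hx => ⟨⟨x, (hmemK x).2 hx⟩, rfl⟩,
    hrank, ?_, ?_⟩
  · have h0 : n / Nat.gcd n j ≠ 0 :=
      (Nat.div_pos (Nat.gcd_le_left _ (Nat.pos_of_ne_zero hn))
        (Nat.gcd_pos_of_pos_left _ (Nat.pos_of_ne_zero hn))).ne'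
    have h1 : Nat.card F = Nat.card K ^ Module.finrank K F := Module.natCard_eq_pow_finrank
    rw [Nat.card_eq_fintype_card, hF, hrank] at h1
    refine (Nat.pow_left_injective h0 ?_).symm
    simp only
    rw [← h1, ← pow_mul, Nat.mul_div_cancel' (Nat.gcd_dvd_left n j)]
  · have hpow : ∀ (l : ℕ) (x : F), (σ ^ l) x = (τ ^ l) x := by
      intro l
      induction l with
      | zero => simp
      | succ l ih => intro x; rw [pow_succ, pow_succ, AlgEquiv.mul_apply, AlgEquiv.mul_apply, ih,
          hσapp]
    ext x
    rw [hpow, ← hord, pow_orderOf_eq_one]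
    rfl

/-- Writing `3 ^ k = 2 a + 1` gives `d = a * 3 ^ k + a + 1`, while `g ^ 3 ^ k = g` because `s ∣ k`;
so `g ^ d = g ^ (2 a + 1) = g`. -/
theorem FiniteField.pow_eq_self_of_dvd {K : Type*} [Field K] [Fintype K] {s k d : ℕ}
    (hK : Fintype.card K = 3 ^ s) (hsk : s ∣ k) (hd : d = (3 ^ (2 * k) + 1) / 2) (g : K) :
    g ^ d = g := by
  obtain ⟨l, rfl⟩ := hsk
  have hpow : g ^ 3 ^ (s * l) = g := by
    rw [pow_mul, ← hK]
    exact FiniteField.pow_card_pow l g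
  set q := 3 ^ (s * l) with hq
  obtain ⟨a, ha⟩ : Odd q := Odd.pow (by decide)
  have hd' : d = a * q + a + 1 := by
    rw [hd, mul_comm 2, pow_mul, ← hq, ha]
    have : (2 * a + 1) ^ 2 + 1 = 2 * (a * (2 * a + 1) + a + 1) := by ring
    omega
  have : g ^ (a * q + a + 1) = g ^ (2 * a + 1) := by
    rw [mul_comm a q, add_assoc, pow_add, pow_mul, hpow, ← pow_add]
    congr 1
    omega
  rw [hd', this, ← ha, hpow]

end Frobenius

/-- The Walsh transform of `x ↦ Tr (x ^ d)`. Substituting `x = y²` and `x = g y²`, for a nonsquare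
`g` of the field of order `3 ^ s`, turns `x ^ d + b x` into `y σ(y) + b y²` and its `g`-multiple,
where `σ(y) = y ^ 3 ^ (2 k)`. -/
theorem walsh_trace_pow {F : Type*} [Field F] [Fintype F]
    [Algebra (ZMod 3) F] {n k s d : ℕ} (hn : n ≠ 0)
    (hd : d = (3 ^ (2 * k) + 1) / 2) (hs : Nat.gcd n k = s) (hodd : Odd (n / s))
    (hF : Fintype.card F = 3 ^ n) {W : F → ℂ}
    (hW : ∀ b, W b = ∑ x, ZMod.stdAddChar (Algebra.trace (ZMod 3) F (x ^ d + b * x))) :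
    (∀ b, W b ≠ 0 → W b * conj (W b) = 3 ^ (n + s)) ∧ ∀ b, W b = 0 ∨ W (-b) = 0 := by
  classical
  have h2k := Nat.gcd_two_mul_of_odd_div hs hodd
  obtain ⟨K, σ, hσ, hfix, hrank, hcard, hpow⟩ :=
    exists_fixedField_pow_three_pow (F := F) hn hF (2 * k)
  rw [h2k] at hrank hcard hpow
  let : Fintype K := Fintype.ofFinite K
  rw [Nat.card_eq_fintype_card] at hcard
  have hcF : CharP F 3 := charP_of_injective_algebraMap (algebraMap (ZMod 3) F).injective 3
  have hcK : CharP K 3 := charP_of_injective_algebraMap (algebraMap (ZMod 3) K).injective 3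
  have hrF : ringChar F ≠ 2 := by rw [ringChar.eq F 3]; decide
  have hrK : ringChar K ≠ 2 := by rw [ringChar.eq K 3]; decide
  have hF2 : (2 : F) ≠ 0 := Ring.two_ne_zero hrF
  obtain ⟨g, hg⟩ := FiniteField.exists_nonsquare hrK
  have hgF : ¬ IsSquare (algebraMap K F g) := by
    rintro ⟨x, hx⟩
    have hsq : σ x * σ x = x * x := by rw [← map_mul, ← hx, AlgEquiv.commutes]
    rcases mul_self_eq_mul_self_iff.1 hsq with h | h
    · obtain ⟨a, rfl⟩ := hfix x h
      exact hg ⟨a, (algebraMap K F).injective (by rw [hx, map_mul])⟩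
    · have h0 := AlgEquiv.eq_zero_of_map_eq_neg hF2 hodd hpow h
      rw [h0, mul_zero, map_eq_zero] at hx
      exact hg (hx ▸ IsSquare.zero)
  have hgd : g ^ d = g := FiniteField.pow_eq_self_of_dvd hcard (hs ▸ Nat.gcd_dvd_right n k) hd g
  have h2d : 2 * d = 3 ^ (2 * k) + 1 := by
    obtain ⟨a, ha⟩ : Odd (3 ^ (2 * k)) := Odd.pow (by decide)
    omega
  set ψ : AddChar K ℂ := (ZMod.stdAddChar (N := 3)).compAddMonoidHom
    (Algebra.trace (ZMod 3) K).toAddMonoidHom with hψdef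
  have hψ : ψ.IsPrimitive :=
    AddChar.isPrimitive_compAddMonoidHom_trace (ZMod.isPrimitive_stdAddChar 3)
  have happ : ∀ x : F, ZMod.stdAddChar (Algebra.trace (ZMod 3) F x) = ψ (Algebra.trace K F x) := by
    intro x
    rw [← Algebra.trace_trace (S := K)]
    rfl
  have hsqd : ∀ y : F, (y ^ 2) ^ d = y * σ y := by
    intro y
    rw [← pow_mul, h2d, pow_succ, hσ, mul_comm]
  have hWS : ∀ b, 2 * W b =
      ∑ y, ψ (twistedForm σ b y) + ∑ y, ψ (g * twistedForm σ b y) := by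
    intro b
    rw [hW, ← FiniteField.sum_comp_sq_add_sum_comp_mul_sq hrF hgF]
    congr 1 <;> refine Finset.sum_congr rfl fun y _ => ?_
    · rw [hsqd, happ, twistedForm_apply]
    · rw [mul_pow, hsqd, ← map_pow, hgd, happ, twistedForm_apply, ← smul_eq_mul g, ← map_smul,
        Algebra.smul_def]
      congr 2
      ring
  have hm : Odd (Module.finrank K F) := hrank ▸ hodd
  have hmain := fun b h => sum_twistedForm_add_nonsquare hrK hψ hfix hm hg b h
  simp only [← hWS] at hmain
  have hW0 : ∀ b, W b ≠ 0 → 2 * W b ≠ 0 := fun b h => mul_ne_zero two_ne_zero h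
  refine ⟨fun b hb => ?_, fun b => ?_⟩
  · have h := (hmain b (hW0 b hb)).1
    have he : s * (n / s + 1) = n + s := by
      rw [mul_add, mul_one, Nat.mul_div_cancel' (hs ▸ Nat.gcd_dvd_left n k)]
    rw [map_mul, Complex.conj_ofNat, hrank, hcard, Nat.cast_pow, ← pow_mul, he] at h
    push_cast at h
    linear_combination h / 4
  · by_contra! hne
    obtain ⟨y, hy, hy0⟩ := Finset.exists_mem_ne (hmain b (hW0 b hne.1)).2 0
    obtain ⟨z, hz, hz0⟩ := Finset.exists_mem_ne (hmain (-b) (hW0 _ hne.2)).2 0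
    exact hz0 (eq_zero_of_mem_twistedRadical_neg hF2 hodd hpow hy hy0 hz)

theorem mainTheorem1 (n k s d : ℕ) (hn : 3 ≤ n) (hk : 1 ≤ k)
    (hd : d = (3 ^ (2 * k) + 1) / 2) (hs : Nat.gcd n k = s) (hodd : Odd (n / s))
    (F : Type*) [Field F] [Fintype F] [DecidableEq F] [Algebra (ZMod 3) F]
    (hF : Fintype.card F = 3 ^ n) :
    (∀ i : ZMod 3, IsPGDS (traceLevelSet F d i) (3 ^ n) (3 ^ (n - 1))
      (3 ^ (2 * n - 3) - 3 ^ (n + s - 3))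
      (3 ^ (n + s - 2) + 3 ^ (2 * n - 3) - 3 ^ (n + s - 3))) ∧
    (∀ i j : ZMod 3, i ≠ j → Disjoint (traceLevelSet F d i) (traceLevelSet F d j)) ∧
    (Finset.univ.biUnion (fun i : ZMod 3 => traceLevelSet F d i) = Finset.univ) := by
  refine ⟨fun i => ?_, fun i j hij => ?_, ?_⟩
  · have hsn : s ≤ n := hs ▸ Nat.gcd_le_left k (by omega)
    have hs1 : 1 ≤ s := hs ▸ Nat.gcd_pos_of_pos_left k (by omega)
    have hdodd : Odd d := by
      have h9 : 3 ^ (2 * k) % 4 = 1 := by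
        rw [pow_mul, Nat.pow_mod]
        norm_num
      rw [Nat.odd_iff]
      omega
    set Ψ : AddChar F ℂ := (ZMod.stdAddChar (N := 3)).compAddMonoidHom
      (Algebra.trace (ZMod 3) F).toAddMonoidHom with hΨdef
    have hΨ : Ψ.IsPrimitive :=
      AddChar.isPrimitive_compAddMonoidHom_trace (ZMod.isPrimitive_stdAddChar 3)
    set W : F → ℂ := fun b =>
      ∑ x, ZMod.stdAddChar (Algebra.trace (ZMod 3) F (x ^ d + b * x)) with hW
    obtain ⟨hC, hsupp⟩ := walsh_trace_pow (by omega) hd hs hodd hF (W := W) (fun b => rfl)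
    obtain ⟨hcard, hsum⟩ := card_mul_sum_diffCount_levelSet hΨ
      (f := fun x => Algebra.trace (ZMod 3) F (x ^ d))
      (fun x => by rw [hdodd.neg_pow, map_neg]) (3 ^ (n + s - 2)) W
      (fun b => Finset.sum_congr rfl fun x _ => by
        rw [map_add, AddChar.map_add_eq_mul]; rfl)
      (fun b hb => by
        rw [hC b hb, show n + s = n + s - 2 + 2 by omega, pow_add, Nat.add_sub_cancel]
        norm_num [mul_comm]) hsupp i
    have hcard' : (traceLevelSet F d i).card = 3 ^ (n - 1) := by
      have h3 : 3 * (traceLevelSet F d i).card = 3 * 3 ^ (n - 1) := by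
        rw [← pow_succ', Nat.sub_add_cancel (by omega), ← hF]
        exact_mod_cast hcard
      omega
    have hle : 3 ^ (n + s - 3) ≤ 3 ^ (2 * n - 3) :=
      Nat.pow_le_pow_right (by norm_num) (by omega)
    have hnat : ∀ x, ∑ y ∈ traceLevelSet F d i, diffCount (traceLevelSet F d i) (x - y) +
        3 ^ (n + s - 3) = 3 ^ (2 * n - 3) +
          3 ^ (n + s - 2) * if x ∈ traceLevelSet F d i then 1 else 0 := by
      intro x
      have h : (Fintype.card F : ℂ) * (∑ y ∈ traceLevelSet F d i,
          diffCount (traceLevelSet F d i) (x - y) : ℕ) =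
        ((traceLevelSet F d i).card : ℂ) ^ 3 - 3 ^ (n + s - 2) * (traceLevelSet F d i).card +
          3 ^ (n + s - 2) * (Fintype.card F * if x ∈ traceLevelSet F d i then 1 else 0) := by
        have hmem : x ∈ traceLevelSet F d i ↔ Algebra.trace (ZMod 3) F (x ^ d) = i := by
          simp [traceLevelSet]
        simp only [hmem]
        exact hsum x
      rw [hcard', hF] at h
      have h0 : (3 : ℂ) ^ n ≠ 0 := pow_ne_zero n (by norm_num)
      have e1 : ((3 : ℂ) ^ (n - 1)) ^ 3 = 3 ^ n * 3 ^ (2 * n - 3) := by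
        rw [← pow_mul, ← pow_add]; congr 1; omega
      have e2 : (3 : ℂ) ^ (n + s - 2) * 3 ^ (n - 1) = 3 ^ n * 3 ^ (n + s - 3) := by
        rw [← pow_add, ← pow_add]; congr 1; omega
      rw [← Nat.cast_inj (R := ℂ)]
      push_cast at h ⊢
      refine mul_left_cancel₀ h0 ?_
      linear_combination h + e1 - e2
    refine ⟨?_, Nat.pow_lt_pow_right (by norm_num) (by omega), ?_, hcard', fun x hx => ?_,
      fun x hx => ?_⟩
    · calc 2 < 3 ^ 1 := by norm_num
        _ ≤ 3 ^ (n - 1) := Nat.pow_le_pow_right (by norm_num) (by omega)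
    · rw [Nat.card_eq_fintype_card, hF]
    · have := hnat x
      rw [if_neg hx] at this
      omega
    · have := hnat x
      rw [if_pos hx] at this
      omega
  · rw [Finset.disjoint_left]
    intro x hi hj
    simp only [traceLevelSet, Finset.mem_filter, Finset.mem_univ, true_and] at hi hj
    exact hij (hi.symm.trans hj)
  · ext x
    simp [traceLevelSet]
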